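/- Let $\mathbb F_2^+$ be the free monoid of finite words in two letters $a,b$, and call the elements of $\{0,1\}^{\mathbb F_2^+}$ (colored binary) trees; for a tree $\mathfrak A$ and $\omega\in\mathbb F_2^+$ let $T_\omega(\mathfrak A)$ be the subtree with root at the site $\omega$, that is $T_\omega(\mathfrak A)_v=\mathfrak A_{\omega v}$. Let $H$ be the map on trees determined recursively as follows: if $\mathfrak A$ is a tree, then $H(\mathfrak A)$ has the same root digit as $\mathfrak A$, it has the digit $1$ at site $a$ and the digit $0$ at site $b$, and its subtrees at the sites $aa,ab,ba,bb$ are $H(T_b\mathfrak A)$, $H(T_b\mathfrak A)$, $H(T_a\mathfrak A)$, $H(T_b\mathfrak A)$ respectively. The map $H$ has a unique fixed point $\mathfrak J$ with root digit $0$, called the Jacaranda tree. For $n\ge 1$ let $\kappa_n$ be the number of patches of size $n$ of $\mathfrak J$, that is, the number of distinct finite trees with $n$ lines $(T_\omega(\mathfrak J)_v)_{|v|<n}$, where $\omega$ ranges over $\mathbb F_2^+$. Then the Petersen–Salama entropy and the Ban–Chang entropy of $\mathfrak J$ are both equal to zero: $$\limsup_{n\to+\infty}\frac1{2^n}\log\kappa_n=0\qquad\text{and}\qquad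 \limsup_{n\to+\infty}\frac1n\log\log\kappa_n=0 .$$ -/

import Mathlib

namespace Jacaranda

/-- The two generators of the free monoid `𝔽₂⁺`. -/
inductive Letter
  | a
  | b
  deriving DecidableEq

instance : Fintype Letter := ⟨{Letter.a, Letter.b}, fun x => by cases x <;> simp⟩

/-- `𝔽₂⁺`: finite words in `a` and `b`; the empty word is `[]` and `|ω|` is `ω.length`. -/
abbrev Word := List Letter

/-- Coloured binary trees, i.e. elements of `{0,1}^{𝔽₂⁺}`. -/
abbrev Tree := Word → Fin 2

/-- `T_ω(A)`: the subtree of `A` whose root is the site `ω` of `A`. -/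
def follower (ω : Word) (A : Tree) : Tree := fun v => A (ω ++ v)

/-- The substreetution `H` given by `0 ↦ 0[1][0]`, `1 ↦ 1[1][0]` with grammar `BBAB`:
a tree with root `r`, `a`-follower `A` and `b`-follower `B` is sent to the tree with root `r`,
digit `1` at site `a`, digit `0` at site `b`, and the subtrees
`H(B), H(B), H(A), H(B)` at the sites `aa, ab, ba, bb`. -/
def H : Tree → Tree
  | A, [] => A []
  | _, [Letter.a] => 1
  | _, [Letter.b] => 0
  | A, Letter.a :: Letter.a :: v => H (follower [Letter.b] A) v
  | A, Letter.a :: Letter.b :: v => H (follower [Letter.b] A) v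
  | A, Letter.b :: Letter.a :: v => H (follower [Letter.a] A) v
  | A, Letter.b :: Letter.b :: v => H (follower [Letter.b] A) v

/-- The digit of `H A` at a word `w` depends only on the digits of `A` at words `u` with
`2 |u| ≤ |w|`. -/
theorem H_congr : ∀ (w : Word) (A B : Tree),
    (∀ u : Word, 2 * u.length ≤ w.length → A u = B u) → H A w = H B w
  | [], A, B, h => by simpa [H] using h [] (by simp)
  | [Letter.a], _, _, _ => by simp [H]
  | [Letter.b], _, _, _ => by simp [H]
  | Letter.a :: Letter.a :: v, A, B, h => by
      simp only [H]
      exact H_congr v _ _ fun u hu => h (Letter.b :: u) (by simp only [List.length_cons]; omega)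
  | Letter.a :: Letter.b :: v, A, B, h => by
      simp only [H]
      exact H_congr v _ _ fun u hu => h (Letter.b :: u) (by simp only [List.length_cons]; omega)
  | Letter.b :: Letter.a :: v, A, B, h => by
      simp only [H]
      exact H_congr v _ _ fun u hu => h (Letter.a :: u) (by simp only [List.length_cons]; omega)
  | Letter.b :: Letter.b :: v, A, B, h => by
      simp only [H]
      exact H_congr v _ _ fun u hu => h (Letter.b :: u) (by simp only [List.length_cons]; omega)

theorem H_root (A : Tree) : H A [] = A [] := by simp [H]

/-- Two trees with the same root have images under `H^n` that agree on all words of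
length at most `n`. -/
theorem H_iterate_congr (A B : Tree) (h : A [] = B []) :
    ∀ (n : ℕ) (w : Word), w.length ≤ n → H^[n] A w = H^[n] B w := by
  intro n
  induction n with
  | zero =>
    intro w hw
    have : w = [] := List.length_eq_zero_iff.mp (by omega)
    simpa [this] using h
  | succ n ih =>
    intro w hw
    rw [Function.iterate_succ_apply', Function.iterate_succ_apply']
    exact H_congr w _ _ fun u hu => ih u (by omega)

/-- `H` has exactly one fixed point with root `0`. -/
theorem existsUnique_fixedPoint : ∃! J : Tree, H J = J ∧ J [] = 0 := by
  have hroot : H (fun _ => 0) [] = (0 : Fin 2) := by simp [H]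
  have hstab : ∀ (n : ℕ) (w : Word), w.length ≤ n →
      H^[n] (fun _ => 0) w = H^[w.length] (fun _ => 0) w := by
    intro n w hw
    induction n, hw using Nat.le_induction with
    | base => rfl
    | succ n hn ih =>
      rw [← ih, Function.iterate_succ_apply]
      exact H_iterate_congr _ _ hroot n w hn
  refine ⟨fun w => H^[w.length] (fun _ => 0) w, ⟨?_, rfl⟩, ?_⟩
  · funext w
    rw [← hstab (w.length + 1) w (by omega), Function.iterate_succ_apply']
    exact H_congr w _ _ fun u hu => (hstab w.length u (by omega)).symm
  · rintro J ⟨hJ, h0⟩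
    funext w
    rw [← H_iterate_congr J _ h0 w.length w le_rfl]
    rw [Function.iterate_fixed hJ]

/-- The Jacaranda tree: the unique fixed point of `H` with root `0`. -/
noncomputable def jacaranda : Tree := existsUnique_fixedPoint.choose

theorem H_jacaranda : H jacaranda = jacaranda := existsUnique_fixedPoint.choose_spec.1.1

theorem jacaranda_root : jacaranda [] = 0 := existsUnique_fixedPoint.choose_spec.1.2

/-- Finite binary coloured trees with `n` lines (the lines `0, …, n - 1`). -/
abbrev FiniteTree (n : ℕ) := {v : Word // v.length < n} → Fin 2

/-- The first `n` lines of a tree. -/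
def firstLines (n : ℕ) (A : Tree) : FiniteTree n := fun v => A v.1

/-- `K_n`: the finite trees with `n` lines that appear in `A`, at some site `ω`. -/
def patches (A : Tree) (n : ℕ) : Set (FiniteTree n) :=
  {C | ∃ ω : Word, firstLines n (follower ω A) = C}

theorem patches_finite (A : Tree) (n : ℕ) : (patches A n).Finite := by
  have : Finite {v : Word // v.length < n} := (List.finite_length_lt Letter n).to_subtype
  exact Set.toFinite _

/-- `κ_n`, the number of patches with `n` lines. -/
noncomputable def kappa (A : Tree) (n : ℕ) : ℕ := (patches A n).ncard

/-- Petersen–Salama entropy `limsup 2⁻ⁿ log κ_n`, as an extended real. -/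
noncomputable def entropyPS (A : Tree) : EReal :=
  Filter.limsup (fun n : ℕ => ((1 / 2 ^ n * Real.log (kappa A n) : ℝ) : EReal)) Filter.atTop

/-- Ban–Chang entropy `limsup (1/n) log log κ_n`, as an extended real. The outer logarithm
is extended by `log 0 = -∞`, so that `log log 1 = -∞`. -/
noncomputable def entropyBC (A : Tree) : EReal :=
  Filter.limsup (fun n : ℕ =>
    ((1 / n : ℝ) : EReal) * ENNReal.log (ENNReal.ofReal (Real.log (kappa A n)))) Filter.atTop

end Jacaranda

namespace Jacaranda

open Filter Topology

/-! Two letters of descent in `H A` amount to one in `A`, so for a fixed point every subtree is `H`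
of another subtree, up to at most one leftover letter. By `H_congr` the first `n` lines of such a
subtree are fixed by that leftover and about `n / 2` lines of the preimage. Hence `κ_n ≤ 3
κ_{n/2+1}` (`kappa_le_three_mul`), and iterating it about `log₂ n` times gives `κ_n = O(n³)`
(`kappa_add_two_le`). Both normalizations kill a polynomial bound; `two_le_kappa` keeps the iterated
logarithm from falling to `-∞`. -/

theorem follower_append (ω v : Word) (A : Tree) :
    follower (ω ++ v) A = follower v (follower ω A) := by
  funext w
  simp [follower]

/-- Every subtree of `H A` is, up to moving down by at most one letter, the image under `H` of a
subtree of `A`. -/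
theorem exists_follower_H : ∀ (ω : Word) (A : Tree), ∃ (s : Option Letter) (ω' : Word),
    follower ω (H A) = follower s.toList (H (follower ω' A))
  | [], A => ⟨none, [], rfl⟩
  | [x], A => ⟨some x, [], rfl⟩
  | x :: y :: ω, A => by
      obtain ⟨z, hz⟩ : ∃ z : Letter, follower [x, y] (H A) = H (follower [z] A) := by
        cases x <;> cases y
        · exact ⟨Letter.b, funext fun v => by simp [follower, H]⟩
        · exact ⟨Letter.b, funext fun v => by simp [follower, H]⟩
        · exact ⟨Letter.a, funext fun v => by simp [follower, H]⟩
        · exact ⟨Letter.b, funext fun v => by simp [follower, H]⟩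
      obtain ⟨s, ω', h⟩ := exists_follower_H ω (follower [z] A)
      refine ⟨s, z :: ω', ?_⟩
      calc follower (x :: y :: ω) (H A) = follower ω (follower [x, y] (H A)) :=
            follower_append [x, y] ω _
        _ = follower s.toList (H (follower ω' (follower [z] A))) := by rw [hz, h]
        _ = _ := by rw [← follower_append]; rfl

/-- Extension of a finite tree by the digit `0`. -/
def extendZero {m : ℕ} (C : FiniteTree m) : Tree :=
  fun u => if h : u.length < m then C ⟨u, h⟩ else 0

theorem extendZero_firstLines {m : ℕ} (A : Tree) {u : Word} (hu : u.length < m) :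
    extendZero (firstLines m A) u = A u := by
  simp [extendZero, firstLines, hu]

/-- A patch of size `n` of a fixed point of `H` is determined by a patch of size `n / 2 + 1` and
one of three positions. -/
theorem patches_subset_image {A : Tree} (hA : H A = A) (n : ℕ) :
    patches A n ⊆ (fun p : Option Letter × FiniteTree (n / 2 + 1) =>
      firstLines n (follower p.1.toList (H (extendZero p.2)))) ''
        (Set.univ ×ˢ patches A (n / 2 + 1)) := by
  rintro _ ⟨ω, rfl⟩
  obtain ⟨s, ω', h⟩ := exists_follower_H ω A
  rw [hA] at h
  refine ⟨(s, firstLines _ (follower ω' A)), ⟨Set.mem_univ _, ω', rfl⟩, ?_⟩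
  funext ⟨v, hv⟩
  rw [h]
  refine H_congr _ _ _ fun u hu => extendZero_firstLines (follower ω' A) ?_
  -- The word read in the image has length at most `1 + (n - 1) = n`, so only words of length at
  -- most `n / 2` matter; hence `n / 2 + 1` lines.
  have hs : s.toList.length ≤ 1 := by cases s <;> simp
  simp only [List.length_append] at hu
  omega

theorem kappa_le_three_mul {A : Tree} (hA : H A = A) (n : ℕ) :
    kappa A n ≤ 3 * kappa A (n / 2 + 1) := by
  have hfin : ((Set.univ : Set (Option Letter)) ×ˢ patches A (n / 2 + 1)).Finite :=
    Set.finite_univ.prod (patches_finite A _)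
  have hcard : (Set.univ : Set (Option Letter)).ncard = 3 := by
    rw [Set.ncard_univ, Nat.card_eq_fintype_card]
    rfl
  calc kappa A n ≤ _ := Set.ncard_le_ncard (patches_subset_image hA n) (hfin.image _)
    _ ≤ _ := Set.ncard_image_le hfin
    _ = 3 * kappa A (n / 2 + 1) := by rw [Set.ncard_prod, hcard]; rfl

/-- The number of patches of a fixed point of `H` grows at most polynomially. -/
theorem kappa_add_two_le {A : Tree} (hA : H A = A) (p : ℕ) :
    kappa A (p + 2) ≤ kappa A 2 * (p + 1) ^ 3 := by
  induction p using Nat.strong_induction_on with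
  | _ p ih =>
    rcases Nat.eq_zero_or_pos p with rfl | hp
    · simp
    have hstep := kappa_le_three_mul hA (p + 2)
    -- Size `2` is fixed by `n ↦ n / 2 + 1`; measured from there, the recursion is plain halving `p
    -- ↦ p / 2`.
    rw [show (p + 2) / 2 + 1 = p / 2 + 2 by omega] at hstep
    -- The exponent `3` works because `p + 1` is at least `3/2` times `p / 2 + 1`, and `(3/2)³ =
    -- 27/8` absorbs the factor `3`.
    have hpow : 3 * (p / 2 + 1) ^ 3 ≤ (p + 1) ^ 3 := by
      rcases Nat.lt_or_ge p 2 with h | h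
      · obtain rfl : p = 1 := by omega
        norm_num
      · have h3 : 3 * (p / 2 + 1) ≤ 2 * (p + 1) := by omega
        have := Nat.pow_le_pow_left h3 3
        rw [mul_pow, mul_pow] at this
        omega
    calc kappa A (p + 2) ≤ 3 * (kappa A 2 * (p / 2 + 1) ^ 3) :=
          hstep.trans (Nat.mul_le_mul_left 3 (ih _ (by omega)))
      _ = kappa A 2 * (3 * (p / 2 + 1) ^ 3) := by ring
      _ ≤ _ := Nat.mul_le_mul_left _ hpow

theorem kappa_le_mul_pow {A : Tree} (hA : H A = A) {n : ℕ} (hn : 2 ≤ n) :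
    kappa A n ≤ kappa A 2 * n ^ 3 := by
  obtain ⟨p, rfl⟩ := Nat.exists_eq_add_of_le' hn
  exact (kappa_add_two_le hA p).trans
    (Nat.mul_le_mul_left _ (Nat.pow_le_pow_left (by omega) 3))

/-- The digits `0` and `1` at the sites `b` and `a` give two different patches of every size. -/
theorem two_le_kappa {A : Tree} (hA : H A = A) {n : ℕ} (hn : 0 < n) : 2 ≤ kappa A n := by
  have ha : A [Letter.a] = 1 := by rw [← hA]; simp [H]
  have hb : A [Letter.b] = 0 := by rw [← hA]; simp [H]
  refine (Set.one_lt_ncard (patches_finite A n)).2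
    ⟨_, ⟨[Letter.a], rfl⟩, _, ⟨[Letter.b], rfl⟩, fun h => ?_⟩
  have := congrFun h ⟨[], by simpa using hn⟩
  simp [firstLines, follower, ha, hb] at this

/-- The crude `log x ≤ x` loses nothing that matters: `n³ / 2ⁿ` and `log (n³) / n` still tend to
`0`. -/
theorem log_kappa_le {A : Tree} (hA : H A = A) {n : ℕ} (hn : 2 ≤ n) :
    Real.log (kappa A n) ≤ kappa A 2 * (n : ℝ) ^ 3 := by
  have h : (kappa A n : ℝ) ≤ kappa A 2 * (n : ℝ) ^ 3 := by
    exact_mod_cast kappa_le_mul_pow hA hn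
  exact (Real.log_le_self (Nat.cast_nonneg _)).trans h

theorem log_two_le_log_kappa {A : Tree} (hA : H A = A) {n : ℕ} (hn : 0 < n) :
    Real.log 2 ≤ Real.log (kappa A n) :=
  Real.log_le_log two_pos (by exact_mod_cast two_le_kappa hA hn)

theorem tendsto_log_kappa_div_two_pow {A : Tree} (hA : H A = A) :
    Tendsto (fun n : ℕ => 1 / 2 ^ n * Real.log (kappa A n)) atTop (𝓝 0) := by
  have hlim : Tendsto (fun n : ℕ => (kappa A 2 : ℝ) * ((n : ℝ) ^ 3 / 2 ^ n)) atTop (𝓝 0) := by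
    simpa using (tendsto_pow_const_div_const_pow_of_one_lt 3 (one_lt_two (α := ℝ))).const_mul
      (kappa A 2 : ℝ)
  refine squeeze_zero' (Eventually.of_forall fun n =>
    mul_nonneg (by positivity) (Real.log_natCast_nonneg _)) ?_ hlim
  filter_upwards [eventually_ge_atTop 2] with n hn
  calc 1 / 2 ^ n * Real.log (kappa A n) ≤ 1 / 2 ^ n * (kappa A 2 * (n : ℝ) ^ 3) :=
        mul_le_mul_of_nonneg_left (log_kappa_le hA hn) (by positivity)
    _ = _ := by ring

/-- Squeeze between the constant `log log 2`, which is negative but harmless after division by `n`,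
and the logarithm of a cubic bound. -/
theorem tendsto_log_log_kappa_div {A : Tree} (hA : H A = A) :
    Tendsto (fun n : ℕ => 1 / (n : ℝ) * Real.log (Real.log (kappa A n))) atTop (𝓝 0) := by
  have hinv : Tendsto (fun n : ℕ => 1 / (n : ℝ)) atTop (𝓝 0) :=
    tendsto_one_div_atTop_nhds_zero_nat
  have hlog : Tendsto (fun n : ℕ => Real.log n / (n : ℝ)) atTop (𝓝 0) :=
    (Real.isLittleO_log_id_atTop.tendsto_div_nhds_zero).comp tendsto_natCast_atTop_atTop
  have hlow : Tendsto (fun n : ℕ => 1 / (n : ℝ) * Real.log (Real.log 2)) atTop (𝓝 0) := by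
    simpa using hinv.mul_const (Real.log (Real.log 2))
  have hup : Tendsto (fun n : ℕ => 1 / (n : ℝ) * Real.log (kappa A 2)
      + 3 * (Real.log n / (n : ℝ))) atTop (𝓝 0) := by
    simpa using (hinv.mul_const (Real.log (kappa A 2))).add (hlog.const_mul 3)
  refine tendsto_of_tendsto_of_tendsto_of_le_of_le' hlow hup ?_ ?_
  · filter_upwards [eventually_gt_atTop 0] with n hn
    exact mul_le_mul_of_nonneg_left
      (Real.log_le_log (Real.log_pos one_lt_two) (log_two_le_log_kappa hA hn)) (by positivity)
  · filter_upwards [eventually_ge_atTop 2] with n hn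
    have hn0 : (n : ℝ) ≠ 0 := by positivity
    have hk0 : (kappa A 2 : ℝ) ≠ 0 := by
      have := two_le_kappa hA two_pos
      positivity
    have hpos : 0 < Real.log (kappa A n) :=
      (Real.log_pos one_lt_two).trans_le (log_two_le_log_kappa hA (by omega))
    calc 1 / (n : ℝ) * Real.log (Real.log (kappa A n))
        ≤ 1 / (n : ℝ) * Real.log (kappa A 2 * (n : ℝ) ^ 3) :=
          mul_le_mul_of_nonneg_left (Real.log_le_log hpos (log_kappa_le hA hn)) (by positivity)
      _ = _ := by
          rw [Real.log_mul hk0 (pow_ne_zero 3 hn0), Real.log_pow]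
          push_cast
          ring

theorem entropyPS_eq_zero {A : Tree} (hA : H A = A) : entropyPS A = 0 :=
  (EReal.tendsto_coe.2 (tendsto_log_kappa_div_two_pow hA)).limsup_eq

theorem entropyBC_eq_zero {A : Tree} (hA : H A = A) : entropyBC A = 0 := by
  refine ((EReal.tendsto_coe.2 (tendsto_log_log_kappa_div hA)).congr' ?_).limsup_eq
  -- The extended and the real outer logarithm agree only where `log κ_n > 0`, which holds for every
  -- `n ≥ 1`.
  filter_upwards [eventually_gt_atTop 0] with n hn
  have hpos : 0 < Real.log (kappa A n) :=
    (Real.log_pos one_lt_two).trans_le (log_two_le_log_kappa hA hn)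
  rw [ENNReal.log_ofReal_of_pos hpos, EReal.coe_mul]

end Jacaranda

theorem mainTheorem3 :
    Jacaranda.entropyPS Jacaranda.jacaranda = 0 ∧
      Jacaranda.entropyBC Jacaranda.jacaranda = 0 :=
  ⟨Jacaranda.entropyPS_eq_zero Jacaranda.H_jacaranda,
    Jacaranda.entropyBC_eq_zero Jacaranda.H_jacaranda⟩
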